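/- Proposition 1.5. Let $K/k$ be a finite extension of (formally) real fields of degree $d=[K:k]$ such that every ordering of $k$ extends to $d$ different orderings of $K$. Let $A$ be a commutative $k$-algebra with unit, let $A_K = A\otimes_k K$, and regard $A$ as a subring of $A_K$ via the injective map $a\mapsto a\otimes 1$. For a commutative ring $B$, let $\Sigma B^2$ denote the set of (finite) sums of squares in $B$. Let $h_1,\dots,h_r\in A$ and put $$M=\Big\{\sum_{i=1}^r s_i h_i : s_1,\dots,s_r\in\Sigma A^2\Big\},\qquad M_K=\Big\{\sum_{i=1}^r t_i h_i : t_1,\dots,t_r\in\Sigma A_K^2\Big\}.$$ Then $A\cap M_K=M$. -/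

import Mathlib

open scoped TensorProduct

/-- The (pseudo) quadratic module generated by `h 0, …, h (r - 1)` in a commutative ring `B`: the
set of all sums `∑ i, s i * h i` with each `s i` a sum of squares in `B`. -/
def pseudoQuadraticModule {B : Type*} [CommRing B] {r : ℕ} (h : Fin r → B) : Set B :=
  {f | ∃ s : Fin r → B, (∀ i, IsSumSq (s i)) ∧ f = ∑ i, s i * h i}

/-- The set of orderings `Q` of the field `K` that extend the ordering `P` of the subfield `k`,
that is, satisfy `Q ∩ k = P`. Orderings are given by their sets of nonnegative elements. -/
def orderingExtensions {k : Type*} (K : Type*) [Field k] [Field K] [Algebra k K]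
    (P : RingPreordering k) : Set (RingPreordering K) :=
  {Q | Q.IsOrdering ∧ ∀ x : k, algebraMap k K x ∈ Q ↔ x ∈ P}

-- Let `d = [K : k]`. Applying the `A`-linear trace of `A ⊗ K` to `a ⊗ 1 = ∑ t i * (h i ⊗ 1)` gives
-- `d * a = ∑ tr (t i) * h i`, and `1 / d` is a sum of squares. So it is enough that traces of sums
-- of squares are sums of squares. Diagonalizing the trace form over `k` reduces this to `tr (x *
-- x)` for `x` in `K` (`IsSumSq.trace_tensorProduct`), and by Artin's theorem one only has to check
-- that `tr (x * x)` lies in every ordering `P` of `k`.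
--
-- Suppose an ordered extension `L` of `(k, P)` induces every extension of `P` to `K` through some
-- embedding `K → L`. Distinct orderings need distinct embeddings, so there are `d` of them, and `tr
-- (x * x) = ∑ σ x * σ x ≥ 0`.
--
-- Such an `L` replaces a real closure. It is found by enlarging `L` as long as an ordering is
-- missed, each time gaining an embedding. Enlarging rests on amalgamation
-- (`exists_ordered_extension_algHom`): if `F / k` is finite and orderable, some residue field of `L
-- ⊗ F` is orderable over `L`. The reason is the signature of the trace form. It is invariant under
-- ordered base change and additive over residue fields; it vanishes for non-orderable fields
-- (`traceSignature_eq_zero`, by Pfister's round forms) and is positive for orderable ones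
-- (`traceSignature_pos`, by induction on the degree).

universe u

/-! ### Preorderings, orderings and Artin's theorem. -/

namespace RingPreordering

/-- The preordering generated by a preordering `T` of a field and the negative of an element which
does not belong to `T`. -/
def adjoinNeg {F : Type*} [Field F] (T : RingPreordering F) (a : F) (ha : a ∉ T) :
    RingPreordering F :=
  RingPreordering.mk' {z | ∃ x ∈ T, ∃ y ∈ T, z = x - a * y}
    (by
      rintro _ _ ⟨x, hx, y, hy, rfl⟩ ⟨x', hx', y', hy', rfl⟩
      exact ⟨x + x', add_mem hx hx', y + y', add_mem hy hy', by ring⟩)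
    (by
      rintro _ _ ⟨x, hx, y, hy, rfl⟩ ⟨x', hx', y', hy', rfl⟩
      exact ⟨x * x' + a * a * (y * y'), add_mem (mul_mem hx hx')
        (mul_mem (T.mul_self_mem a) (mul_mem hy hy')), x * y' + y * x',
        add_mem (mul_mem hx hy') (mul_mem hy hx'), by ring⟩)
    (fun x ↦ ⟨x * x, T.mul_self_mem x, 0, zero_mem T, by ring⟩)
    (by
      rintro ⟨x, hx, y, hy, h⟩
      by_cases hy0 : y = 0
      · subst hy0
        rw [mul_zero, sub_zero] at h
        exact T.neg_one_notMem (h ▸ hx)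
      · apply ha
        have : a = (1 + x) * y⁻¹ := by
          field_simp
          linear_combination h
        rw [this]
        exact mul_mem (add_mem (one_mem T) hx) (RingPreordering.inv_mem hy))

/-- In a field, any element outside a preordering `T` lies outside an ordering containing `T`. -/
theorem exists_isOrdering_notMem {F : Type*} [Field F] (T : RingPreordering F) {a : F}
    (ha : a ∉ T) : ∃ Q : RingPreordering F, Q.IsOrdering ∧ T ≤ Q ∧ a ∉ Q := by
  have hadj : ∀ (S : RingPreordering F) (b : F) (hb : b ∉ S), S ≤ S.adjoinNeg b hb :=
    fun S b hb x hx ↦ ⟨x, hx, 0, zero_mem S, by ring⟩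
  have hneg : ∀ (S : RingPreordering F) (b : F) (hb : b ∉ S), -b ∈ S.adjoinNeg b hb :=
    fun S b hb ↦ ⟨0, zero_mem S, 1, one_mem S, by ring⟩
  -- Zorn starts from `T` with `-a` adjoined, so `a ∈ Q` would force `a = 0 ∈ T`.
  obtain ⟨Q, hTQ, hQ⟩ := zorn_le_nonempty₀ (Set.univ : Set (RingPreordering F))
    (fun c _ hc S hS ↦ by
      refine ⟨RingPreordering.mk' {x | ∃ U ∈ c, x ∈ U} ?_ ?_ ?_ ?_, trivial, ?_⟩
      · rintro x y ⟨U, hU, hx⟩ ⟨V, hV, hy⟩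
        rcases hc.total hU hV with h | h
        · exact ⟨V, hV, add_mem (h hx) hy⟩
        · exact ⟨U, hU, add_mem hx (h hy)⟩
      · rintro x y ⟨U, hU, hx⟩ ⟨V, hV, hy⟩
        rcases hc.total hU hV with h | h
        · exact ⟨V, hV, mul_mem (h hx) hy⟩
        · exact ⟨U, hU, mul_mem hx (h hy)⟩
      · exact fun x ↦ ⟨S, hS, S.mul_self_mem x⟩
      · rintro ⟨U, -, hU⟩
        exact U.neg_one_notMem hU
      · exact fun U hU x hx ↦ ⟨U, hU, hx⟩)
    (T.adjoinNeg a ha) trivial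
  have hmem : ∀ b, b ∉ Q → -b ∈ Q := fun b hb ↦
    hQ.2 trivial (hadj Q b hb) (hneg Q b hb)
  refine ⟨Q, ?_, (hadj T a ha).trans hTQ, fun haQ ↦ ?_⟩
  · have : HasMemOrNegMem Q := ⟨fun b ↦ or_iff_not_imp_left.2 (hmem b)⟩
    exact { }
  · have h0 := RingPreordering.eq_zero_of_mem_of_neg_mem haQ (hTQ (hneg T a ha))
    exact ha (h0 ▸ zero_mem T)

/-- An ordering of a field is the nonnegative cone of a linear order. -/
theorem IsOrdering.exists_linearOrder {F : Type*} [Field F] {Q : RingPreordering F}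
    (hQ : Q.IsOrdering) :
    ∃ _ : LinearOrder F, IsStrictOrderedRing F ∧ ∀ x : F, 0 ≤ x ↔ x ∈ Q := by
  classical
  let C : RingCone F :=
    { Q.toSubsemiring with
      eq_zero_of_mem_of_neg_mem' := fun h h' ↦ RingPreordering.eq_zero_of_mem_of_neg_mem h h' }
  have : HasMemOrNegMem C := ⟨fun x ↦ mem_or_neg_mem Q x⟩
  let o : LinearOrder F := LinearOrder.mkOfAddGroupCone C
  have ho : IsOrderedRing F := IsOrderedRing.mkOfCone C
  refine ⟨o, inferInstance, fun x ↦ ?_⟩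
  change x - 0 ∈ C ↔ _
  rw [sub_zero]
  rfl

/-- The nonnegative elements of an ordered field. -/
def nonneg (F : Type*) [Field F] [LinearOrder F] [IsStrictOrderedRing F] : RingPreordering F :=
  RingPreordering.mk' {x | 0 ≤ x} add_nonneg mul_nonneg mul_self_nonneg (by simp)

theorem mem_nonneg {F : Type*} [Field F] [LinearOrder F] [IsStrictOrderedRing F] {x : F} :
    x ∈ nonneg F ↔ 0 ≤ x := .rfl

theorem nonneg_isOrdering (F : Type*) [Field F] [LinearOrder F] [IsStrictOrderedRing F] :
    (nonneg F).IsOrdering := by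
  have : HasMemOrNegMem (nonneg F) :=
    ⟨fun x ↦ (le_total 0 x).imp id fun h ↦ mem_nonneg.2 (neg_nonneg.2 h)⟩
  exact { }

/-- **Artin's theorem**: an element of a formally real field which belongs to every ordering is a
sum of squares. -/
theorem isSumSq_of_forall_mem {F : Type*} [Field F] [IsFormallyReal F] {a : F}
    (h : ∀ P : RingPreordering F, P.IsOrdering → a ∈ P) : IsSumSq a := by
  by_contra ha
  let T : RingPreordering F := RingPreordering.mk' {x | IsSumSq x} (fun h h' ↦ h.add h')
    (fun h h' ↦ h.mul h') (fun x ↦ .mul_self x)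
    (fun h ↦ one_ne_zero (IsFormallyReal.eq_zero_of_isSumSq_of_neg_isSumSq IsSumSq.one h))
  obtain ⟨Q, hQ, -, haQ⟩ := T.exists_isOrdering_notMem ha
  exact haQ (h Q hQ)

end RingPreordering

/-! ### Orderability relative to an ordered base field. -/

/-- The algebra `F` over the ordered field `k` has an ordering containing the nonnegative elements
of `k`. -/
def IsOrderableOver (k F : Type*) [Field k] [LinearOrder k] [Field F] [Algebra k F] : Prop :=
  ∃ Q : RingPreordering F, Q.IsOrdering ∧ ∀ x : k, 0 ≤ x → algebraMap k F x ∈ Q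

section

variable {k F : Type*} [Field k] [LinearOrder k] [Field F] [Algebra k F]

theorem isOrderableOver_of_le [LinearOrder F] [IsStrictOrderedRing F]
    (h : ∀ x : k, 0 ≤ x → 0 ≤ algebraMap k F x) : IsOrderableOver k F :=
  ⟨.nonneg F, RingPreordering.nonneg_isOrdering F, h⟩

theorem IsOrderableOver.exists_linearOrder (h : IsOrderableOver k F) :
    ∃ _ : LinearOrder F, IsStrictOrderedRing F ∧ ∀ x : k, 0 ≤ x → 0 ≤ algebraMap k F x := by
  obtain ⟨Q, hQ, hkQ⟩ := h
  obtain ⟨o, ho, h⟩ := hQ.exists_linearOrder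
  exact ⟨o, ho, fun x hx ↦ (h _).2 (hkQ x hx)⟩

variable [IsStrictOrderedRing k]

variable (k F) in
/-- The submonoid of elements `p * x ^ 2` with `p` a positive element of the ground field. -/
def posMulSq : Submonoid F where
  carrier := {y | ∃ p : k, 0 < p ∧ ∃ x : F, y = algebraMap k F p * (x * x)}
  one_mem' := ⟨1, one_pos, 1, by simp⟩
  mul_mem' := by
    rintro _ _ ⟨p, hp, x, rfl⟩ ⟨q, hq, y, rfl⟩
    exact ⟨p * q, mul_pos hp hq, x * y, by rw [map_mul]; ring⟩

/-- The generators are closed under products, so their additive closure is already a semiring. It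
contains all squares and lies in every compatible ordering, so `-1` is the only obstruction. -/
theorem isOrderableOver_iff :
    IsOrderableOver k F ↔ (-1 : F) ∉ AddSubmonoid.closure (posMulSq k F : Set F) := by
  constructor
  · rintro ⟨Q, hQ, hkQ⟩ h
    have hle : AddSubmonoid.closure (posMulSq k F : Set F) ≤ Q.toSubsemiring.toAddSubmonoid := by
      rw [AddSubmonoid.closure_le]
      rintro _ ⟨p, hp, x, rfl⟩
      exact mul_mem (S := RingPreordering F) (hkQ p hp.le) (Q.mul_self_mem x)
    exact Q.neg_one_notMem (hle h)
  · intro h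
    have hS : ∀ {x}, x ∈ (posMulSq k F).subsemiringClosure ↔
        x ∈ AddSubmonoid.closure (posMulSq k F : Set F) := fun {x} ↦ by
      rw [← SetLike.mem_coe, Submonoid.subsemiringClosure_coe, SetLike.mem_coe]
    let T : RingPreordering F := RingPreordering.mk' ((posMulSq k F).subsemiringClosure : Set F)
      add_mem mul_mem
      (fun x ↦ hS.2 (AddSubmonoid.subset_closure ⟨1, one_pos, x, by simp⟩))
      (fun h' ↦ h (hS.1 h'))
    obtain ⟨Q, hQ, hTQ, -⟩ := T.exists_isOrdering_notMem T.neg_one_notMem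
    refine ⟨Q, hQ, fun x hx ↦ ?_⟩
    rcases hx.eq_or_lt with rfl | hx
    · rw [map_zero]
      exact zero_mem Q
    · exact hTQ (hS.2 (AddSubmonoid.subset_closure ⟨x, hx, 1, by simp⟩))

/-- A functional which is positive on squares witnesses the existence of an ordering. -/
theorem isOrderableOver_of_linearMap (f : F →ₗ[k] k) (h1 : 0 < f 1) (h : ∀ x, 0 ≤ f (x * x)) :
    IsOrderableOver k F := by
  rw [isOrderableOver_iff]
  intro hneg
  have : ∀ y ∈ AddSubmonoid.closure (posMulSq k F : Set F), 0 ≤ f y := by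
    intro y hy
    induction hy using AddSubmonoid.closure_induction with
    | mem y hy =>
      obtain ⟨p, hp, x, rfl⟩ := hy
      rw [← Algebra.smul_def, map_smul]
      exact smul_nonneg hp.le (h x)
    | zero => simp
    | add x y _ _ hx hy => rw [map_add]; exact add_nonneg hx hy
  have := this _ hneg
  rw [map_neg] at this
  linarith

end

/-! ### Adjoining square roots of nonnegative elements. -/

/-- An ordered field has an ordered extension in which a given nonnegative element is a square. -/
theorem exists_ordered_extension_isSquare {K : Type u} [Field K] [LinearOrder K]
    [IsStrictOrderedRing K] (a : K) (ha : 0 ≤ a) :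
    ∃ (F : Type u) (_ : Field F) (_ : LinearOrder F) (_ : IsStrictOrderedRing F)
      (_ : Algebra K F), FiniteDimensional K F ∧ (∀ x : K, 0 ≤ x → 0 ≤ algebraMap K F x) ∧
      IsSquare (algebraMap K F a) := by
  by_cases hsq : IsSquare a
  · exact ⟨K, inferInstance, inferInstance, inferInstance, inferInstance, inferInstance,
      fun _ h ↦ h, hsq⟩
  · have : Fact (∀ r : K, r ^ 2 ≠ a + 0 * r) :=
      ⟨fun r hr ↦ hsq ⟨r, by rw [← sq, hr]; ring⟩⟩
    have hF : IsOrderableOver K (QuadraticAlgebra K a 0) := by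
      -- The functional is the coordinate at `1`: on the square of `u + v√a` it takes the value `u²
      -- + a v²`.
      refine isOrderableOver_of_linearMap
        { toFun := fun z ↦ z.re, map_add' := fun _ _ ↦ rfl, map_smul' := fun _ _ ↦ rfl } ?_ ?_
      · exact one_pos
      · intro z
        change 0 ≤ (z * z).re
        have := mul_nonneg ha (mul_self_nonneg z.im)
        have h' := mul_self_nonneg z.re
        rw [QuadraticAlgebra.re_mul]
        linarith
    obtain ⟨o, ho, h⟩ := hF.exists_linearOrder
    refine ⟨QuadraticAlgebra K a 0, inferInstance, o, ho, inferInstance, inferInstance, h, ⟨⟨0, 1⟩, ?_⟩⟩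
    ext <;> simp

/-- An ordered field has an ordered extension in which finitely many given nonnegative elements are
squares. -/
theorem exists_ordered_extension_forall_isSquare {K : Type u} [Field K] [LinearOrder K]
    [IsStrictOrderedRing K] (l : List K) (hl : ∀ a ∈ l, 0 ≤ a) :
    ∃ (F : Type u) (_ : Field F) (_ : LinearOrder F) (_ : IsStrictOrderedRing F)
      (_ : Algebra K F), FiniteDimensional K F ∧ (∀ x : K, 0 ≤ x → 0 ≤ algebraMap K F x) ∧
      ∀ a ∈ l, IsSquare (algebraMap K F a) := by
  induction l with
  | nil =>
    exact ⟨K, inferInstance, inferInstance, inferInstance, inferInstance, inferInstance,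
      fun _ h ↦ h, by simp⟩
  | cons a l ih =>
    obtain ⟨F, _, _, _, _, _, hKF, hsq⟩ := ih fun b hb ↦ hl b (List.mem_cons_of_mem a hb)
    obtain ⟨E, _, _, _, _, _, hFE, hsq'⟩ := exists_ordered_extension_isSquare
      (algebraMap K F a) (hKF a (hl a List.mem_cons_self))
    let : Algebra K E := ((algebraMap F E).comp (algebraMap K F)).toAlgebra
    have : IsScalarTower K F E := .of_algebraMap_eq fun _ ↦ rfl
    refine ⟨E, inferInstance, inferInstance, inferInstance, inferInstance,
      FiniteDimensional.trans K F E, fun x hx ↦ hFE _ (hKF x hx), fun b hb ↦ ?_⟩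
    rcases List.mem_cons.1 hb with rfl | hb
    · exact hsq'
    · exact (hsq b hb).map (algebraMap F E)

/-! ### Signatures of quadratic forms. -/

namespace QuadraticForm

section

variable {k V W : Type*} [Field k] [LinearOrder k] [AddCommGroup V] [Module k V]
  [AddCommGroup W] [Module k W]

/-- The signature of a quadratic form over an ordered field. -/
noncomputable def signature (Q : QuadraticForm k V) : ℤ := sigPos Q - sigNeg Q

theorem signature_congr {Q : QuadraticForm k V} {Q' : QuadraticForm k W}
    (h : QuadraticMap.Equivalent Q Q') : signature Q = signature Q' := by
  rw [signature, signature, h.sigPos_eq, h.sigNeg_eq]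

/-- If there is a similarity of factor `-1`, the signature vanishes. -/
theorem signature_eq_zero_of_comp_eq_neg [FiniteDimensional k V] (Q : QuadraticForm k V)
    (M : V →ₗ[k] V) (hM : ∀ v, Q (M v) = -Q v) : signature Q = 0 := by
  -- `M` carries a maximal positive definite subspace injectively onto a negative definite one. The
  -- reverse inequality is this one for `-Q`.
  have key : ∀ Q : QuadraticForm k V, (∀ v, Q (M v) = -Q v) → sigPos Q ≤ sigNeg Q := by
    intro Q hM
    obtain ⟨U, hU, hpos⟩ := exists_finrank_eq_sigPos_and_posDef Q
    have hval : ∀ v ∈ U, v ≠ 0 → 0 < Q v := fun v hv hv0 ↦ by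
      simpa using hpos ⟨v, hv⟩ (by simpa using hv0)
    have hinj : Function.Injective (M.domRestrict U) := by
      rw [← LinearMap.ker_eq_bot, LinearMap.ker_eq_bot']
      rintro ⟨v, hv⟩ h0
      by_contra hne
      have h0' : M v = 0 := h0
      have h1 := hM v
      rw [h0', map_zero] at h1
      have h2 := hval v hv (by simpa using hne)
      rw [neg_eq_zero.1 h1.symm] at h2
      exact lt_irrefl _ h2
    have hrank := LinearMap.finrank_range_of_inj hinj
    rw [← hU, ← hrank]
    refine le_sigNeg_of_negDef (V := LinearMap.range (M.domRestrict U)) (Q := Q) ?_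
    rintro ⟨_, v, rfl⟩ hne
    have hv0 : (v : V) ≠ 0 := by
      rintro h
      apply hne
      ext
      simp [h]
    have := hval v v.2 hv0
    simpa [hM] using this
  have h1 := key Q hM
  have h2 := key (-Q) fun v ↦ by simp [hM]
  rw [sigPos_neg, sigNeg_neg] at h2
  rw [signature, le_antisymm h1 h2, sub_self]

end

section

variable {k V : Type*} [Field k] [LinearOrder k] [IsStrictOrderedRing k] [AddCommGroup V]
  [Module k V] {ι : Type*} [Fintype ι]

theorem signature_weightedSumSquares (w : ι → k) :
    signature (QuadraticMap.weightedSumSquares k w) = ∑ i, (SignType.sign (w i) : ℤ) := by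
  classical
  have h : ∀ i, (SignType.sign (w i) : ℤ) = (if 0 < w i then 1 else 0) - if w i < 0 then 1 else 0 := by
    intro i
    rcases lt_trichotomy (w i) 0 with h | h | h
    · simp [h, h.not_gt]
    · simp [h]
    · simp [h, h.not_gt]
  rw [signature, sigPos_weightedSumSquares, sigNeg_weightedSumSquares, Finset.sum_congr rfl
    fun i _ ↦ h i, Finset.sum_sub_distrib, Finset.sum_boole, Finset.sum_boole,
    Set.ncard_eq_toFinset_card', Set.ncard_eq_toFinset_card']
  simp

/-- The signature computed in an orthogonal basis. -/
theorem signature_eq_sum_sign (Q : QuadraticForm k V) (b : Module.Basis ι k V)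
    (hb : ∀ i j, i ≠ j → QuadraticMap.polar Q (b i) (b j) = 0) :
    signature Q = ∑ i, (SignType.sign (Q (b i)) : ℤ) := by
  have : Invertible (2 : k) := invertibleOfNonzero two_ne_zero
  rw [← signature_weightedSumSquares, ← QuadraticMap.basisRepr_eq_of_iIsOrtho Q b]
  · exact signature_congr ⟨QuadraticMap.isometryEquivBasisRepr Q b⟩
  · intro i j hij
    have h : ⅟(2 : k) • QuadraticMap.polar Q (b i) (b j) = 0 := by rw [hb i j hij, smul_zero]
    simpa [Function.onFun, QuadraticMap.associated_apply, QuadraticMap.polar] using h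

theorem exists_basis_polar_eq_zero [FiniteDimensional k V] (Q : QuadraticForm k V) :
    ∃ b : Module.Basis (Fin (Module.finrank k V)) k V,
      ∀ i j, i ≠ j → QuadraticMap.polar Q (b i) (b j) = 0 := by
  have : Invertible (2 : k) := invertibleOfNonzero two_ne_zero
  obtain ⟨b, hb⟩ := LinearMap.BilinForm.exists_orthogonal_basis
    (QuadraticForm.associated_isSymm k Q)
  refine ⟨b, fun i j hij ↦ ?_⟩
  have h : QuadraticMap.associated (R := k) Q (b i) (b j) = 0 := hb hij
  rw [← QuadraticMap.polarBilin_apply_apply, ← QuadraticMap.two_nsmul_associated k Q,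
    two_nsmul, LinearMap.add_apply, LinearMap.add_apply, h, add_zero]

theorem signature_smul [FiniteDimensional k V] (Q : QuadraticForm k V) {c : k} (hc : 0 < c) :
    signature (c • Q) = signature Q := by
  obtain ⟨b, hb⟩ := exists_basis_polar_eq_zero Q
  rw [signature_eq_sum_sign Q b hb, signature_eq_sum_sign (c • Q) b fun i j hij ↦ by
    rw [FunLike.coe_smul, QuadraticMap.polar_smul, hb i j hij, smul_zero]]
  refine Finset.sum_congr rfl fun i _ ↦ ?_
  rw [smul_apply, smul_eq_mul, sign_mul, sign_pos hc, one_mul]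

theorem signature_pi {V : ι → Type*} [∀ i, AddCommGroup (V i)] [∀ i, Module k (V i)]
    [∀ i, FiniteDimensional k (V i)] (Q : ∀ i, QuadraticForm k (V i)) :
    signature (QuadraticMap.pi Q) = ∑ i, signature (Q i) := by
  classical
  choose b hb using fun i ↦ exists_basis_polar_eq_zero (Q i)
  have hval : ∀ i (x : V i), QuadraticMap.pi Q (Pi.single i x) = Q i x :=
    fun i x ↦ QuadraticMap.pi_apply_single Q i x
  rw [signature_eq_sum_sign (QuadraticMap.pi Q) (Pi.basis b), Fintype.sum_sigma]
  · refine Finset.sum_congr rfl fun i _ ↦ ?_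
    rw [signature_eq_sum_sign (Q i) (b i) (hb i)]
    simp only [Pi.basis_apply, hval]
  · rintro ⟨i, x⟩ ⟨j, y⟩ hne
    rw [Pi.basis_apply, Pi.basis_apply]
    have hpolar : ∀ x y, QuadraticMap.polar (QuadraticMap.pi Q) x y =
        ∑ l, QuadraticMap.polar (Q l) (x l) (y l) := fun x y ↦ by
      simp [QuadraticMap.polar, QuadraticMap.pi_apply, Finset.sum_sub_distrib]
    rw [hpolar]
    refine Finset.sum_eq_zero fun l _ ↦ ?_
    by_cases hi : l = i
    · subst hi
      by_cases hj : l = j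
      · subst hj
        simpa using hb l x y fun h ↦ hne (by rw [h])
      · simp [Pi.single_eq_of_ne hj]
    · simp [Pi.single_eq_of_ne hi]

end

end QuadraticForm

/-! ### The signature of the trace form. -/

section Trace

variable (k B : Type*) [Field k] [CommRing B] [Algebra k B]

/-- The quadratic form `x ↦ tr (x ^ 2)` of a finite algebra. -/
noncomputable def traceQuadraticForm : QuadraticForm k B :=
  (Algebra.traceForm k B).toQuadraticMap

variable {k B}

theorem traceQuadraticForm_apply (x : B) :
    traceQuadraticForm k B x = Algebra.trace k B (x * x) := rfl

theorem polar_traceQuadraticForm (x y : B) :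
    QuadraticMap.polar (traceQuadraticForm k B) x y = 2 * Algebra.trace k B (x * y) := by
  simp only [QuadraticMap.polar, traceQuadraticForm_apply, ← map_sub]
  rw [show (x + y) * (x + y) - x * x - y * y = x * y + x * y by ring, map_add, two_mul]

variable (k B) in
/-- The signature of the trace form of a finite algebra over an ordered field. -/
noncomputable def traceSignature [LinearOrder k] : ℤ := (traceQuadraticForm k B).signature

variable {C : Type*} [CommRing C] [Algebra k C]

theorem traceSignature_congr [LinearOrder k] (e : B ≃ₐ[k] C) :
    traceSignature k B = traceSignature k C :=
  QuadraticForm.signature_congr ⟨{ e.toLinearEquiv with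
    map_app' := fun x ↦ by
      change traceQuadraticForm k C (e x) = _
      rw [traceQuadraticForm_apply, traceQuadraticForm_apply, ← map_mul,
        Algebra.trace_eq_of_algEquiv] }⟩

theorem Algebra.trace_pi_apply {R ι : Type*} [CommRing R] [Nontrivial R] [Fintype ι] {S : ι → Type*}
    [∀ i, CommRing (S i)] [∀ i, Algebra R (S i)] [∀ i, Module.Free R (S i)]
    [∀ i, Module.Finite R (S i)] (x : ∀ i, S i) :
    Algebra.trace R (∀ i, S i) x = ∑ i, Algebra.trace R (S i) (x i) := by
  classical
  let b := fun i ↦ Module.Free.chooseBasis R (S i)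
  rw [Algebra.trace_eq_matrix_trace (Pi.basis b), Matrix.trace, Fintype.sum_sigma]
  refine Finset.sum_congr rfl fun i _ ↦ ?_
  rw [Algebra.trace_eq_matrix_trace (b i), Matrix.trace]
  refine Finset.sum_congr rfl fun j _ ↦ ?_
  simp [Algebra.leftMulMatrix_eq_repr_mul]

theorem traceSignature_pi [LinearOrder k] [IsStrictOrderedRing k] {ι : Type*} [Fintype ι]
    (S : ι → Type*) [∀ i, CommRing (S i)] [∀ i, Algebra k (S i)]
    [∀ i, FiniteDimensional k (S i)] :
    traceSignature k (∀ i, S i) = ∑ i, traceSignature k (S i) := by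
  have : traceQuadraticForm k (∀ i, S i) =
      QuadraticMap.pi fun i ↦ traceQuadraticForm k (S i) := by
    ext x
    simp [traceQuadraticForm_apply, Algebra.trace_pi_apply]
  simp only [traceSignature, this, QuadraticForm.signature_pi]

theorem traceSignature_self [LinearOrder k] [IsStrictOrderedRing k] : traceSignature k k = 1 := by
  rw [traceSignature, QuadraticForm.signature_eq_sum_sign _ (Module.Basis.singleton Unit k)]
  · simp [traceQuadraticForm_apply]
  · intro i j hij
    exact absurd (Subsingleton.elim i j) hij

theorem Algebra.trace_tensorProduct_one_tmul {R S A : Type*} [CommRing R] [CommRing S]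
    [Algebra R S] [Module.Free R S] [Module.Finite R S] [CommRing A] [Algebra R A] (x : S) :
    Algebra.trace A (A ⊗[R] S) (1 ⊗ₜ x) = algebraMap R A (Algebra.trace R S x) := by
  rw [Algebra.trace_apply, ← Algebra.baseChange_lmul, LinearMap.trace_baseChange,
    Algebra.trace_apply]

/-- The signature of the trace form is invariant under ordered base change. -/
theorem traceSignature_baseChange [LinearOrder k] [IsStrictOrderedRing k] [FiniteDimensional k B]
    {L : Type*} [Field L] [LinearOrder L] [IsStrictOrderedRing L] [Algebra k L]
    (hL : ∀ x : k, 0 ≤ x → 0 ≤ algebraMap k L x) :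
    traceSignature L (L ⊗[k] B) = traceSignature k B := by
  obtain ⟨b, hb⟩ := QuadraticForm.exists_basis_polar_eq_zero (traceQuadraticForm k B)
  rw [traceSignature, traceSignature, QuadraticForm.signature_eq_sum_sign _ b hb,
    QuadraticForm.signature_eq_sum_sign _ (Algebra.TensorProduct.basis L b)]
  · refine Finset.sum_congr rfl fun i _ ↦ ?_
    rw [Algebra.TensorProduct.basis_apply, traceQuadraticForm_apply, traceQuadraticForm_apply,
      Algebra.TensorProduct.tmul_mul_tmul, one_mul, Algebra.trace_tensorProduct_one_tmul]
    generalize Algebra.trace k B (b i * b i) = c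
    have hpos : ∀ c : k, 0 < c → 0 < algebraMap k L c := fun c hc ↦
      (hL c hc.le).lt_of_ne' (by simpa using hc.ne')
    congr 1
    rcases lt_trichotomy c 0 with h | rfl | h
    · have := hpos (-c) (neg_pos.2 h)
      rw [map_neg, neg_pos] at this
      rw [sign_neg h, sign_neg this]
    · simp
    · rw [sign_pos h, sign_pos (hpos c h)]
  · intro i j hij
    have h := hb i j hij
    rw [polar_traceQuadraticForm, mul_eq_zero, or_iff_right two_ne_zero] at h
    rw [polar_traceQuadraticForm, Algebra.TensorProduct.basis_apply,
      Algebra.TensorProduct.basis_apply, Algebra.TensorProduct.tmul_mul_tmul, one_mul,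
      Algebra.trace_tensorProduct_one_tmul, h, map_zero, mul_zero]

/-- After an ordered base change, the signature of the trace form of a finite field extension is
the sum of the signatures of the residue fields. -/
theorem traceSignature_eq_sum_maximalSpectrum [LinearOrder k] [IsStrictOrderedRing k]
    {K : Type*} [Field K] [Algebra k K] [FiniteDimensional k K]
    (L : Type*) [Field L] [LinearOrder L] [IsStrictOrderedRing L] [Algebra k L]
    (hL : ∀ x : k, 0 ≤ x → 0 ≤ algebraMap k L x) [Fintype (MaximalSpectrum (L ⊗[k] K))] :
    traceSignature k K =
      ∑ m : MaximalSpectrum (L ⊗[k] K), traceSignature L ((L ⊗[k] K) ⧸ m.asIdeal) := by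
  -- In characteristic zero `K / k` is separable, so `L ⊗ K` is reduced Artinian, hence the product
  -- of its residue fields.
  have : Algebra.FormallyUnramified k K := Algebra.FormallyUnramified.of_isSeparable k K
  have : IsReduced (L ⊗[k] K) := Algebra.FormallyUnramified.isReduced_of_field L _
  have : IsArtinianRing (L ⊗[k] K) := IsArtinianRing.of_finite L _
  rw [← traceSignature_baseChange hL,
    traceSignature_congr ((IsArtinianRing.equivPi (L ⊗[k] K)).restrictScalars L),
    traceSignature_pi]

end Trace

/-! ### Round forms. -/

section Pfister

variable {F : Type*} [Field F] {ι : Type*} [Fintype ι]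

/-- A diagonal form is round when each of its values is a similarity factor. -/
def IsRound (w : ι → F) : Prop :=
  ∀ x : ι → F, ∃ M : (ι → F) →ₗ[F] (ι → F), ∀ v, QuadraticMap.weightedSumSquares F w (M v) =
    QuadraticMap.weightedSumSquares F w x * QuadraticMap.weightedSumSquares F w v

theorem weightedSumSquares_sumElim_smul (w : ι → F) (p : F) (v : ι ⊕ ι → F) :
    QuadraticMap.weightedSumSquares F (Sum.elim w (p • w)) v =
      QuadraticMap.weightedSumSquares F w (v ∘ Sum.inl) +
        p * QuadraticMap.weightedSumSquares F w (v ∘ Sum.inr) := by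
  simp [QuadraticMap.weightedSumSquares_apply, Finset.mul_sum, mul_assoc]

/-- **Pfister**: the product of a round form and a binary form `⟨1, p⟩` is round. -/
theorem IsRound.sumElim {w : ι → F} (h : IsRound w) (p : F) : IsRound (Sum.elim w (p • w)) := by
  intro x
  set φ := QuadraticMap.weightedSumSquares F w with hφ
  obtain ⟨M₁, h₁⟩ := h (x ∘ Sum.inl)
  obtain ⟨M₂, h₂⟩ := h (x ∘ Sum.inr)
  rw [← hφ] at h₁ h₂
  set c₁ := φ (x ∘ Sum.inl)
  set c₂ := φ (x ∘ Sum.inr)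
  have hx : QuadraticMap.weightedSumSquares F (Sum.elim w (p • w)) x = c₁ + p * c₂ :=
    weightedSumSquares_sumElim_smul w p x
  let l : (ι ⊕ ι → F) →ₗ[F] (ι → F) := LinearMap.funLeft F F Sum.inl
  let r : (ι ⊕ ι → F) →ₗ[F] (ι → F) := LinearMap.funLeft F F Sum.inr
  have pair : ∀ a b : (ι ⊕ ι → F) →ₗ[F] (ι → F),
      (∀ v, φ (a v) + p * φ (b v) = (c₁ + p * c₂) * (φ (l v) + p * φ (r v))) →
      ∃ M : (ι ⊕ ι → F) →ₗ[F] (ι ⊕ ι → F), ∀ v,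
        QuadraticMap.weightedSumSquares F (Sum.elim w (p • w)) (M v) =
          QuadraticMap.weightedSumSquares F (Sum.elim w (p • w)) x *
            QuadraticMap.weightedSumSquares F (Sum.elim w (p • w)) v := by
    intro a b hab
    refine ⟨(LinearEquiv.sumArrowLequivProdArrow ι ι F F).symm.toLinearMap ∘ₗ a.prod b,
      fun v ↦ ?_⟩
    rw [hx, weightedSumSquares_sumElim_smul, weightedSumSquares_sumElim_smul]
    exact hab v
  -- The degenerate cases avoid dividing by `c₁ * c₂`.
  by_cases hc₁ : c₁ = 0
  · refine pair (p • M₂ ∘ₗ r) (M₂ ∘ₗ l) fun v ↦ ?_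
    simp only [LinearMap.smul_apply, LinearMap.comp_apply, QuadraticMap.map_smul, h₂, smul_eq_mul,
      hc₁]
    ring
  by_cases hc₂ : c₂ = 0
  · refine pair (M₁ ∘ₗ l) (M₁ ∘ₗ r) fun v ↦ ?_
    simp only [LinearMap.comp_apply, h₁, hc₂]
    ring
  -- `N` scales `φ` by `1 / (c₁ * c₂)`. The coefficients `-(p * c₂)` and `c₁` used below make the
  -- two polar terms cancel.
  · let N : (ι ⊕ ι → F) →ₗ[F] (ι → F) := (c₁ * c₂)⁻¹ • M₁ ∘ₗ M₂ ∘ₗ r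
    have hN : ∀ v, c₁ * c₂ * φ (N v) = φ (r v) := by
      intro v
      simp only [N, LinearMap.smul_apply, LinearMap.comp_apply, QuadraticMap.map_smul, h₁, h₂,
        smul_eq_mul]
      field_simp
    have hadd : ∀ (y z : ι → F) (s : F),
        φ (y + s • z) = φ y + s * QuadraticMap.polar φ y z + s * s * φ z := by
      intro y z s
      rw [QuadraticMap.map_add φ, QuadraticMap.map_smul, QuadraticMap.polar_smul_right]
      simp only [smul_eq_mul]
      ring
    refine pair (M₁ ∘ₗ (l + (-(p * c₂)) • N)) (M₂ ∘ₗ (l + c₁ • N)) fun v ↦ ?_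
    simp only [LinearMap.comp_apply, LinearMap.add_apply, LinearMap.smul_apply, h₁, h₂, hadd]
    rw [← hN v]
    ring

end Pfister

/-! ### Vanishing of the signature for non-orderable extensions. -/

section

variable {k F : Type*} [Field k] [LinearOrder k] [IsStrictOrderedRing k] [Field F] [Algebra k F]

/-- Each sum of terms `p * x ^ 2` with positive `p` in the ground field is represented by a round
diagonal form with positive coefficients in the ground field. -/
theorem exists_isRound_of_mem_closure {y : F}
    (hy : y ∈ AddSubmonoid.closure (posMulSq k F : Set F)) :
    ∃ (ι : Type) (_ : Fintype ι) (w : ι → k), Nonempty ι ∧ (∀ i, 0 < w i) ∧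
      IsRound (fun i ↦ algebraMap k F (w i)) ∧
      (∃ e, QuadraticMap.weightedSumSquares F (fun i ↦ algebraMap k F (w i)) e = 1) ∧
      ∃ x, QuadraticMap.weightedSumSquares F (fun i ↦ algebraMap k F (w i)) x = y := by
  induction hy using AddSubmonoid.closure_induction_left with
  | zero =>
    -- The form `⟨1⟩` rather than the empty form: a vector of value `1` is needed in the induction,
    -- and a nonzero number of coefficients in the application.
    refine ⟨Unit, inferInstance, 1, inferInstance, fun _ ↦ one_pos, fun x ↦ ?_, ⟨1, ?_⟩, ⟨0, ?_⟩⟩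
    · refine ⟨x () • LinearMap.id, fun v ↦ ?_⟩
      simp [QuadraticMap.weightedSumSquares_apply]
      ring
    · simp [QuadraticMap.weightedSumSquares_apply]
    · simp
  | add_left z hz y _ ih =>
    obtain ⟨p, hp, x, rfl⟩ := hz
    obtain ⟨ι, _, w, _, hw, hround, ⟨e, he⟩, ⟨t, ht⟩⟩ := ih
    have hfun : (fun i ↦ algebraMap k F (Sum.elim w (p • w) i)) =
        Sum.elim (fun i ↦ algebraMap k F (w i))
          (algebraMap k F p • fun i ↦ algebraMap k F (w i)) := by
      ext (i | i) <;> simp [Algebra.smul_def]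
    refine ⟨ι ⊕ ι, inferInstance, Sum.elim w (p • w), inferInstance, ?_, ?_, ?_, ?_⟩
    · rintro (i | i)
      · exact hw i
      · exact mul_pos hp (hw i)
    · rw [hfun]
      exact hround.sumElim _
    · refine ⟨Sum.elim e 0, ?_⟩
      rw [hfun, weightedSumSquares_sumElim_smul, Sum.elim_comp_inl, Sum.elim_comp_inr, he, map_zero,
        mul_zero, add_zero]
    -- Since `e` has value `1`, the second block contributes `p * x ^ 2`.
    · refine ⟨Sum.elim t (x • e), ?_⟩
      rw [hfun, weightedSumSquares_sumElim_smul, Sum.elim_comp_inl, Sum.elim_comp_inr, ht,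
        QuadraticMap.map_smul, he, smul_eq_mul, mul_one, add_comm]

/-- The trace form of a finite extension with no compatible ordering has signature zero. -/
theorem traceSignature_eq_zero [FiniteDimensional k F] (h : ¬ IsOrderableOver k F) :
    traceSignature k F = 0 := by
  rw [isOrderableOver_iff, not_not] at h
  obtain ⟨ι, _, w, _, hw, hround, -, ⟨x, hx⟩⟩ := exists_isRound_of_mem_closure h
  obtain ⟨M, hM⟩ := hround x
  -- The trace transfer of the round form. As `-1` is a value of that form, `M` becomes a similarity
  -- of factor `-1`; the signature of `Q` is also the number of coefficients times that of the trace
  -- form.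
  let Q : QuadraticForm k (ι → F) := QuadraticMap.pi fun i ↦ w i • traceQuadraticForm k F
  have hQ : ∀ v, Q v = Algebra.trace k F
      (QuadraticMap.weightedSumSquares F (fun i ↦ algebraMap k F (w i)) v) := by
    intro v
    simp [Q, QuadraticMap.weightedSumSquares_apply, traceQuadraticForm_apply, ← Algebra.smul_def]
  have h0 : Q.signature = 0 := by
    refine QuadraticForm.signature_eq_zero_of_comp_eq_neg Q (M.restrictScalars k) fun v ↦ ?_
    rw [hQ, hQ, LinearMap.restrictScalars_apply, hM, hx, neg_one_mul, map_neg]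
  rw [QuadraticForm.signature_pi] at h0
  simp only [QuadraticForm.signature_smul _ (hw _), Finset.sum_const, Finset.card_univ,
    nsmul_eq_mul, mul_eq_zero, Nat.cast_eq_zero, Fintype.card_ne_zero, false_or] at h0
  exact h0

end

/-! ### Positivity of the signature and amalgamation. -/

section

variable {k : Type*} {F : Type u} [Field k] [LinearOrder k] [IsStrictOrderedRing k] [Field F]
  [Algebra k F]

/-- If `F` has a compatible ordering and the residue fields of `F ⊗ F` of smaller degree have
nonnegative signature, then the trace form of `F` has positive signature. -/
theorem traceSignature_pos_of_isOrderableOver_of_forall [FiniteDimensional k F]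
    [LinearOrder F] [IsStrictOrderedRing F] (hF : ∀ x : k, 0 ≤ x → 0 ≤ algebraMap k F x)
    (ih : ∀ (E : Type u) [Field E] [Algebra F E] [FiniteDimensional F E],
      Module.finrank F E < Module.finrank k F → 0 ≤ traceSignature F E) :
    0 < traceSignature k F := by
  classical
  have : IsArtinianRing (F ⊗[k] F) := IsArtinianRing.of_finite F _
  have : Fintype (MaximalSpectrum (F ⊗[k] F)) := Fintype.ofFinite _
  rw [traceSignature_eq_sum_maximalSpectrum F hF]
  -- The kernel of multiplication is a maximal ideal with residue field `F`, which contributes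
  -- exactly `1`.
  let μ : F ⊗[k] F →ₐ[F] F := Algebra.TensorProduct.lift (Algebra.ofId F F) (AlgHom.id k F)
    fun _ _ ↦ Commute.all _ _
  have hμ : Function.Surjective μ := fun x ↦ ⟨x ⊗ₜ 1, by simp [μ]⟩
  let m₀ : MaximalSpectrum (F ⊗[k] F) :=
    ⟨RingHom.ker μ, RingHom.ker_isMaximal_of_surjective μ hμ⟩
  let e₀ : ((F ⊗[k] F) ⧸ m₀.asIdeal) ≃ₐ[F] F := Ideal.quotientKerAlgEquivOfSurjective hμ
  have h₀ : traceSignature F ((F ⊗[k] F) ⧸ m₀.asIdeal) = 1 := by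
    rw [traceSignature_congr e₀, traceSignature_self]
  have hsum : ∀ m ∈ Finset.univ.erase m₀,
      0 ≤ traceSignature F ((F ⊗[k] F) ⧸ m.asIdeal) := by
    intro m hm
    let : Field ((F ⊗[k] F) ⧸ m.asIdeal) := Ideal.Quotient.field _
    refine ih ((F ⊗[k] F) ⧸ m.asIdeal) ?_
    have hne : m₀ ≠ m := fun h ↦ Finset.ne_of_mem_erase hm h.symm
    -- By the Chinese remainder theorem the residue field at `m` together with `F` fits into
    -- dimension `[F : k]`, so its degree is strictly smaller.
    let f : F ⊗[k] F →ₗ[F] F × ((F ⊗[k] F) ⧸ m.asIdeal) :=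
      μ.toLinearMap.prod (Ideal.Quotient.mkₐ F m.asIdeal).toLinearMap
    have hf : Function.Surjective f := by
      have := m₀.isMaximal
      have hcop : IsCoprime m₀.asIdeal m.asIdeal :=
        Ideal.isCoprime_of_isMaximal fun h ↦ hne (MaximalSpectrum.ext h)
      obtain ⟨a, ha, b, hb, hab⟩ := Ideal.isCoprime_iff_exists.1 hcop
      rintro ⟨x, y⟩
      obtain ⟨x, rfl⟩ := hμ x
      obtain ⟨y, rfl⟩ := Ideal.Quotient.mk_surjective y
      have hμa : μ a = 0 := ha
      have hμb : μ b = 1 := by simpa [hμa] using congrArg μ hab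
      have hmb : Ideal.Quotient.mk m.asIdeal b = 0 := Ideal.Quotient.eq_zero_iff_mem.2 hb
      have hma : Ideal.Quotient.mk m.asIdeal a = 1 := by
        simpa [hmb] using congrArg (Ideal.Quotient.mk m.asIdeal) hab
      refine ⟨b * x + a * y, ?_⟩
      ext <;> simp [f, hμa, hμb, hma, hmb]
    have hle := LinearMap.finrank_le_finrank_of_surjective hf
    rw [Module.finrank_prod, Module.finrank_self, Module.finrank_baseChange] at hle
    omega
  rw [← Finset.add_sum_erase _ _ (Finset.mem_univ m₀), h₀]
  have := Finset.sum_nonneg hsum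
  omega

end

/-- The trace form of a finite extension of an ordered field has nonnegative signature. -/
theorem traceSignature_nonneg (n : ℕ) : ∀ (k F : Type u) [Field k] [LinearOrder k]
    [IsStrictOrderedRing k] [Field F] [Algebra k F] [FiniteDimensional k F],
    Module.finrank k F = n → 0 ≤ traceSignature k F := by
  -- The base field varies along the induction: the residue fields of `F ⊗ F` are extensions of `F`.
  induction n using Nat.strong_induction_on with
  | _ n ih =>
    intro k F _ _ _ _ _ _ hn
    by_cases h : IsOrderableOver k F
    · obtain ⟨_, _, hF⟩ := h.exists_linearOrder
      refine (traceSignature_pos_of_isOrderableOver_of_forall hF ?_).le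
      intro E _ _ _ hE
      exact ih _ (hn ▸ hE) F E rfl
    · rw [traceSignature_eq_zero h]

section

variable {k : Type*} {F : Type u} [Field k] [LinearOrder k] [IsStrictOrderedRing k] [Field F]
  [Algebra k F] [FiniteDimensional k F]

theorem traceSignature_pos (h : IsOrderableOver k F) : 0 < traceSignature k F := by
  obtain ⟨_, _, hF⟩ := h.exists_linearOrder
  exact traceSignature_pos_of_isOrderableOver_of_forall hF
    fun E _ _ _ _ ↦ traceSignature_nonneg _ F E rfl

/-- Amalgamation: an ordered extension `L` of `k` has an ordered extension into which a given
finite orderable extension of `k` embeds. -/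
theorem exists_ordered_extension_algHom (h : IsOrderableOver k F) (L : Type u) [Field L]
    [LinearOrder L] [IsStrictOrderedRing L] [Algebra k L]
    (hL : ∀ x : k, 0 ≤ x → 0 ≤ algebraMap k L x) :
    ∃ (E : Type u) (_ : Field E) (_ : LinearOrder E) (_ : IsStrictOrderedRing E) (_ : Algebra k E),
      (∀ x : k, 0 ≤ x → 0 ≤ algebraMap k E x) ∧ Nonempty (F →ₐ[k] E) ∧
      ∃ f : L →ₐ[k] E, ∀ x, 0 ≤ x → 0 ≤ f x := by
  have : IsArtinianRing (L ⊗[k] F) := IsArtinianRing.of_finite L _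
  have : Fintype (MaximalSpectrum (L ⊗[k] F)) := Fintype.ofFinite _
  have hpos := traceSignature_pos h
  rw [traceSignature_eq_sum_maximalSpectrum L hL] at hpos
  -- A residue field of nonzero signature is orderable over `L`.
  obtain ⟨m, -, hm⟩ := Finset.exists_ne_zero_of_sum_ne_zero hpos.ne'
  let : Field ((L ⊗[k] F) ⧸ m.asIdeal) := Ideal.Quotient.field _
  have hord : IsOrderableOver L ((L ⊗[k] F) ⧸ m.asIdeal) := by
    by_contra hno
    exact hm (traceSignature_eq_zero hno)
  obtain ⟨o, ho, hLE⟩ := hord.exists_linearOrder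
  refine ⟨(L ⊗[k] F) ⧸ m.asIdeal, inferInstance, o, ho, inferInstance, fun x hx ↦ ?_,
    ⟨(Ideal.Quotient.mkₐ k m.asIdeal).comp Algebra.TensorProduct.includeRight⟩,
    IsScalarTower.toAlgHom k L _, hLE⟩
  rw [IsScalarTower.algebraMap_apply k L]
  exact hLE _ (hL x hx)

end

/-! ### Realizing all orderings by embeddings into one ordered field. -/

section

variable {k : Type*} {K : Type u} [Field k] [LinearOrder k] [IsStrictOrderedRing k] [Field K]
  [Algebra k K] [FiniteDimensional k K]

/-- If an ordering `Q` of `K` over `k` is not induced by an embedding of `K` into the ordered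
extension `L` of `k`, then some ordered extension of `k` admits more embeddings of `K`. -/
theorem exists_ordered_extension_card_algHom_lt (Q : RingPreordering K) (hQ : Q.IsOrdering)
    (hkQ : ∀ x : k, 0 ≤ x → algebraMap k K x ∈ Q) (L : Type u) [Field L] [LinearOrder L]
    [IsStrictOrderedRing L] [Algebra k L] (hL : ∀ x : k, 0 ≤ x → 0 ≤ algebraMap k L x)
    (hno : ∀ σ : K →ₐ[k] L, ∃ a ∈ Q, σ a < 0) :
    ∃ (E : Type u) (_ : Field E) (_ : LinearOrder E) (_ : IsStrictOrderedRing E) (_ : Algebra k E),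
      (∀ x : k, 0 ≤ x → 0 ≤ algebraMap k E x) ∧ Nat.card (K →ₐ[k] L) < Nat.card (K →ₐ[k] E) := by
  obtain ⟨_, _, hKQ⟩ := hQ.exists_linearOrder
  choose a haQ ha using hno
  -- Every witness `a σ` becomes a square in `F`, so an embedding of `F` into `E` restricts to an
  -- embedding of `K` different from every `f.comp σ`.
  obtain ⟨F, _, _, _, _, _, hKF, hsq⟩ := exists_ordered_extension_forall_isSquare
    ((Finset.univ : Finset (K →ₐ[k] L)).toList.map a) (by
      simp only [List.mem_map, forall_exists_index, and_imp]
      rintro _ σ - rfl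
      exact (hKQ _).2 (haQ σ))
  let : Algebra k F := ((algebraMap K F).comp (algebraMap k K)).toAlgebra
  have : IsScalarTower k K F := .of_algebraMap_eq fun _ ↦ rfl
  have : FiniteDimensional k F := FiniteDimensional.trans k K F
  obtain ⟨E, _, _, _, _, hE, ⟨g⟩, f, hf⟩ := exists_ordered_extension_algHom (k := k) (F := F)
    (isOrderableOver_of_le fun x hx ↦ hKF _ ((hKQ _).2 (hkQ x hx))) L hL
  refine ⟨E, inferInstance, inferInstance, inferInstance, inferInstance, hE, ?_⟩
  rw [Nat.card_eq_fintype_card, Nat.card_eq_fintype_card]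
  refine Fintype.card_lt_of_injective_of_notMem (fun σ ↦ f.comp σ)
    (fun σ τ h ↦ AlgHom.ext fun x ↦ f.injective (DFunLike.congr_fun h x))
    (b := g.comp (IsScalarTower.toAlgHom k K F)) ?_
  rintro ⟨σ, hσ⟩
  have h1 : f (σ (a σ)) = g (algebraMap K F (a σ)) := DFunLike.congr_fun hσ (a σ)
  obtain ⟨y, hy⟩ := hsq (a σ) (List.mem_map_of_mem (Finset.mem_toList.2 (Finset.mem_univ σ)))
  have h2 : 0 ≤ f (-σ (a σ)) := hf _ (neg_nonneg.2 (ha σ).le)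
  rw [map_neg, h1, hy, map_mul] at h2
  have h3 : g y * g y = 0 := le_antisymm (neg_nonneg.1 h2) (mul_self_nonneg _)
  have h4 : f (σ (a σ)) = 0 := by rw [h1, hy, map_mul, h3]
  rw [map_eq_zero_iff f f.injective] at h4
  exact (ha σ).ne h4

/-- There is an ordered extension `L` of `k` such that each ordering of `K` over `k` is induced by
an embedding into `L`. -/
theorem exists_ordered_extension_forall_exists_algHom (hK : IsOrderableOver k K) :
    ∃ (L : Type u) (_ : Field L) (_ : LinearOrder L) (_ : IsStrictOrderedRing L) (_ : Algebra k L),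
      (∀ x : k, 0 ≤ x → 0 ≤ algebraMap k L x) ∧
      ∀ Q : RingPreordering K, Q.IsOrdering → (∀ x : k, 0 ≤ x → algebraMap k K x ∈ Q) →
        ∃ σ : K →ₐ[k] L, ∀ a ∈ Q, 0 ≤ σ a := by
  by_contra! hcon
  -- Otherwise the number of embeddings grows without bound, although it is at most `[K : k]`.
  have key : ∀ n : ℕ, ∃ (L : Type u) (_ : Field L) (_ : LinearOrder L) (_ : IsStrictOrderedRing L)
      (_ : Algebra k L), (∀ x : k, 0 ≤ x → 0 ≤ algebraMap k L x) ∧ n ≤ Nat.card (K →ₐ[k] L) := by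
    intro n
    induction n with
    | zero =>
      obtain ⟨o, ho, h⟩ := hK.exists_linearOrder
      exact ⟨K, inferInstance, o, ho, inferInstance, h, Nat.zero_le _⟩
    | succ n ih =>
      obtain ⟨L, _, _, _, _, hL, hn⟩ := ih
      obtain ⟨Q, hQ, hkQ, hno⟩ := hcon L _ _ inferInstance _ hL
      obtain ⟨E, _, _, _, _, hE, hlt⟩ :=
        exists_ordered_extension_card_algHom_lt Q hQ hkQ L hL hno
      exact ⟨E, _, _, inferInstance, _, hE, hn.trans_lt hlt⟩
  obtain ⟨L, _, _, _, _, -, hn⟩ := key (Module.finrank k K + 1)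
  exact absurd (card_algHom_le_finrank k K L) (by omega)

/-- If all embeddings of `K` into an algebraic closure of the ordered extension `L` have values
in `L`, then the trace form is nonnegative. -/
theorem trace_mul_self_nonneg_of_card_algHom (L : Type*) [Field L] [LinearOrder L]
    [IsStrictOrderedRing L] [Algebra k L] (hL : ∀ x : k, 0 ≤ x → 0 ≤ algebraMap k L x)
    (hcard : Module.finrank k K ≤ Fintype.card (K →ₐ[k] L)) (x : K) :
    0 ≤ Algebra.trace k K (x * x) := by
  let E := AlgebraicClosure L
  let ι : L →ₐ[k] E := IsScalarTower.toAlgHom k L E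
  have hinj : Function.Injective fun σ : K →ₐ[k] L ↦ ι.comp σ :=
    fun σ τ h ↦ AlgHom.ext fun x ↦ ι.injective (DFunLike.congr_fun h x)
  -- By the count, every embedding into the algebraic closure factors through `L`, so the trace is a
  -- sum of squares of conjugates in `L`.
  have hbij : Function.Bijective fun σ : K →ₐ[k] L ↦ ι.comp σ := by
    rw [Fintype.bijective_iff_injective_and_card]
    refine ⟨hinj, (Fintype.card_le_of_injective _ hinj).antisymm ?_⟩
    rwa [AlgHom.card k K E]
  have htrace : algebraMap k L (Algebra.trace k K (x * x)) = ∑ σ : K →ₐ[k] L, σ x * σ x := by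
    refine ι.injective (?_ : ι _ = ι _)
    rw [AlgHom.commutes, trace_eq_sum_embeddings E, map_sum]
    exact (Fintype.sum_bijective _ hbij _ _ fun σ ↦ by simp).symm
  by_contra! hneg
  have h1 := hL _ (neg_nonneg.2 hneg.le)
  have h2 : 0 ≤ algebraMap k L (Algebra.trace k K (x * x)) :=
    htrace ▸ Finset.sum_nonneg fun σ _ ↦ mul_self_nonneg _
  rw [map_neg] at h1
  have h3 := le_antisymm (neg_nonneg.1 h1) h2
  rw [map_eq_zero_iff _ (algebraMap k L).injective] at h3
  exact hneg.ne h3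

end

/-- If the ordering `P` of `k` has `[K : k]` extensions to `K`, then the trace form of `K` is
nonnegative with respect to `P`. -/
theorem trace_mul_self_mem_of_encard_orderingExtensions {k K : Type*} [Field k] [Field K]
    [Algebra k K] [FiniteDimensional k K] {P : RingPreordering k} (hP : P.IsOrdering)
    (h : (orderingExtensions K P).encard = (Module.finrank k K : ℕ∞)) (x : K) :
    Algebra.trace k K (x * x) ∈ P := by
  obtain ⟨_, _, hPk⟩ := hP.exists_linearOrder
  have hext : ∀ Q ∈ orderingExtensions K P, ∀ x : k, 0 ≤ x → algebraMap k K x ∈ Q :=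
    fun Q hQ x hx ↦ (hQ.2 x).2 ((hPk x).1 hx)
  have hne : (orderingExtensions K P).Nonempty := by
    rw [← Set.encard_ne_zero, h, Nat.cast_ne_zero]
    exact Module.finrank_pos.ne'
  obtain ⟨Q₀, hQ₀⟩ := hne
  obtain ⟨L, _, _, _, _, hL, hσ⟩ :=
    exists_ordered_extension_forall_exists_algHom (k := k) (K := K) ⟨Q₀, hQ₀.1, hext Q₀ hQ₀⟩
  have hσ' : ∀ Q : orderingExtensions K P, ∃ σ : K →ₐ[k] L, ∀ a ∈ Q.1, 0 ≤ σ a :=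
    fun Q ↦ hσ Q.1 Q.2.1 (hext Q.1 Q.2)
  choose σ hσ using hσ'
  -- The order pulled back along `σ Q` contains `Q`, and comparable orderings coincide; so `σ Q`
  -- determines `Q`.
  have hmem : ∀ (Q : orderingExtensions K P) (a : K), a ∈ Q.1 ↔ 0 ≤ σ Q a := by
    refine fun Q a ↦ ⟨hσ Q a, fun ha ↦ ?_⟩
    have := Q.2.1
    rcases mem_or_neg_mem Q.1 a with h | h
    · exact h
    · have h' := hσ Q _ h
      rw [map_neg] at h'
      have h0 := le_antisymm (neg_nonneg.1 h') ha
      rw [(map_eq_zero_iff (σ Q) (σ Q).injective).1 h0]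
      exact zero_mem Q.1
  have hinj : Function.Injective σ := fun Q Q' hQ ↦
    Subtype.ext (SetLike.ext fun a ↦ by rw [hmem, hmem, hQ])
  have hcard : Module.finrank k K ≤ Fintype.card (K →ₐ[k] L) := by
    rw [← Nat.cast_le (α := ℕ∞), ← h, ← ENat.card_coe_set_eq, ← Nat.card_eq_fintype_card,
      ← ENat.card_eq_coe_natCard]
    exact ENat.card_le_card_of_injective hinj
  exact (hPk _).1 (trace_mul_self_nonneg_of_card_algHom L hL hcard x)

/-! ### Descent along the trace. -/

/-- If traces of squares in `K` are sums of squares in `k`, then traces of sums of squares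
in `A ⊗ K` are sums of squares in `A`. -/
theorem IsSumSq.trace_tensorProduct {k K A : Type*} [Field k] [CharZero k] [Field K] [Algebra k K]
    [CommRing A] [Algebra k A] [FiniteDimensional k K]
    (h : ∀ x : K, IsSumSq (Algebra.trace k K (x * x))) {t : A ⊗[k] K} (ht : IsSumSq t) :
    IsSumSq (Algebra.trace A (A ⊗[k] K) t) := by
  have : Invertible (2 : k) := invertibleOfNonzero two_ne_zero
  have hsymm : LinearMap.IsSymm (Algebra.traceForm k K) :=
    ⟨fun x y ↦ by simp [Algebra.traceForm_apply, mul_comm]⟩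
  obtain ⟨b, hb⟩ := LinearMap.BilinForm.exists_orthogonal_basis hsymm
  have hmap : ∀ c : k, IsSumSq c → IsSumSq (algebraMap k A c) := by
    intro c hc
    induction hc with
    | zero => rw [map_zero]; exact .zero
    | sq_add a _ ih => rw [map_add, map_mul]; exact .sq_add _ ih
  induction ht with
  | zero => rw [map_zero]; exact .zero
  | sq_add z _ ih =>
    rw [map_add]
    refine IsSumSq.add ?_ ih
    let B := Algebra.TensorProduct.basis A b
    have hB : ∀ i j, Algebra.trace A (A ⊗[k] K) (B i * B j) =
        algebraMap k A (Algebra.trace k K (b i * b j)) := by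
      intro i j
      rw [Algebra.TensorProduct.basis_apply, Algebra.TensorProduct.basis_apply,
        Algebra.TensorProduct.tmul_mul_tmul, one_mul, Algebra.trace_tensorProduct_one_tmul]
    -- An orthogonal basis over `k` stays orthogonal over `A`, so only the diagonal entries, which
    -- come from `k`, survive.
    have hz : Algebra.trace A (A ⊗[k] K) (z * z) = ∑ i,
        B.repr z i * B.repr z i * algebraMap k A (Algebra.trace k K (b i * b i)) := by
      conv_lhs => rw [← B.sum_repr z]
      rw [Finset.sum_mul_sum, map_sum]
      refine Finset.sum_congr rfl fun i _ ↦ ?_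
      rw [map_sum, Finset.sum_eq_single i]
      · rw [smul_mul_smul_comm, map_smul, hB, smul_eq_mul]
      · intro j _ hji
        have h0 : Algebra.traceForm k K (b i) (b j) = 0 := hb hji.symm
        rw [smul_mul_smul_comm, map_smul, hB, ← Algebra.traceForm_apply, h0, map_zero, smul_zero]
      · simp
    rw [hz]
    exact IsSumSq.sum fun i _ ↦ (IsSumSq.mul_self _).mul (hmap _ (h (b i)))

theorem proposition1p5 {k K A : Type*} [Field k] [Field K] [Algebra k K]
    [CommRing A] [Algebra k A] [IsFormallyReal k] [IsFormallyReal K] [FiniteDimensional k K]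
    (hord : ∀ P : RingPreordering k, P.IsOrdering →
      (orderingExtensions K P).encard = (Module.finrank k K : ℕ∞))
    (r : ℕ) (h : Fin r → A) :
    {a : A | a ⊗ₜ[k] (1 : K) ∈
      pseudoQuadraticModule (fun i => h i ⊗ₜ[k] (1 : K) : Fin r → A ⊗[k] K)} =
      pseudoQuadraticModule h := by
  ext a
  constructor
  · rintro ⟨t, ht, hat⟩
    have hn0 : ((Module.finrank k K : ℕ) : k) ≠ 0 := by
      intro h0
      have hpos : 0 < Module.finrank k K := Module.finrank_pos
      obtain ⟨n, hn⟩ := Nat.exists_eq_succ_of_ne_zero hpos.ne'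
      rw [hn, Nat.cast_succ, add_comm] at h0
      exact one_ne_zero
        (IsFormallyReal.eq_zero_of_add_right (R := k) IsSumSq.one (IsSumSq.natCast n) h0)
    have hchar : CharZero k := charZero_of_inj_zero fun n hn ↦ by
      by_contra hn'
      obtain ⟨n, rfl⟩ := Nat.exists_eq_succ_of_ne_zero hn'
      rw [Nat.cast_succ, add_comm] at hn
      exact one_ne_zero
        (IsFormallyReal.eq_zero_of_add_right (R := k) IsSumSq.one (IsSumSq.natCast n) hn)
    have htr : ∀ x : K, IsSumSq (Algebra.trace k K (x * x)) := fun x ↦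
      RingPreordering.isSumSq_of_forall_mem fun P hP ↦
        trace_mul_self_mem_of_encard_orderingExtensions hP (hord P hP) x
    have hsmul : ∀ b : A, b ⊗ₜ[k] (1 : K) = b • (1 : A ⊗[k] K) := fun b ↦ by
      rw [Algebra.TensorProduct.one_def, TensorProduct.smul_tmul', smul_eq_mul, mul_one]
    have hone : Algebra.trace A (A ⊗[k] K) 1 = (Module.finrank k K : A) := by
      rw [Algebra.TensorProduct.one_def, Algebra.trace_tensorProduct_one_tmul,
        ← map_one (algebraMap k K), Algebra.trace_algebraMap, nsmul_eq_mul, mul_one, map_natCast]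
    have htrace := congrArg (Algebra.trace A (A ⊗[k] K)) hat
    rw [hsmul, map_smul, hone, map_sum] at htrace
    simp only [hsmul, mul_smul_comm, mul_one, map_smul, smul_eq_mul] at htrace
    let c : A := algebraMap k A (Module.finrank k K : k)⁻¹
    have hc : (Module.finrank k K : A) * c = 1 := by
      rw [← map_natCast (algebraMap k A), ← map_mul, mul_inv_cancel₀ hn0, map_one]
    have hcsq : IsSumSq c := by
      -- `1 / d = d * (1 / d)²`, and a natural number is a sum of squares.
      have : c = (Module.finrank k K : A) * (c * c) := by rw [← mul_assoc, hc, one_mul]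
      rw [this]
      exact (IsSumSq.natCast _).mul (.mul_self c)
    refine ⟨fun i ↦ c * Algebra.trace A (A ⊗[k] K) (t i),
      fun i ↦ hcsq.mul (IsSumSq.trace_tensorProduct htr (ht i)), ?_⟩
    calc a = c * (a * (Module.finrank k K : A)) := by linear_combination -a * hc
      _ = _ := by
        rw [htrace, Finset.mul_sum]
        exact Finset.sum_congr rfl fun i _ ↦ by ring
  · rintro ⟨s, hs, rfl⟩
    refine ⟨fun i ↦ s i ⊗ₜ 1, fun i ↦ ?_, ?_⟩
    · have hmap : ∀ b : A, IsSumSq b → IsSumSq (b ⊗ₜ[k] (1 : K)) := by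
        intro b hb
        induction hb with
        | zero => rw [TensorProduct.zero_tmul]; exact .zero
        | sq_add a _ ih =>
          rw [TensorProduct.add_tmul, ← mul_one (1 : K), ← Algebra.TensorProduct.tmul_mul_tmul,
            mul_one]
          exact .sq_add _ ih
      exact hmap _ (hs i)
    · rw [TensorProduct.sum_tmul]
      simp [Algebra.TensorProduct.tmul_mul_tmul]
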